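/- Let $\mathbb F_q$ be a finite field with $q$ elements. A prime of $\mathbb F_q[T]$ is a monic irreducible polynomial. Let $\mathcal S$ be a set of primes of $\mathbb F_q[T]$ with natural density $\delta(\mathcal S)$, i.e. the limit $$\delta(\mathcal S)=\lim_{n\to\infty}\frac{\#\{P\in\mathcal S:\deg P=n\}}{\#\{P\text{ prime}:\deg P=n\}}$$ exists. For monic $A\in\mathbb F_q[T]$, let $\mu(A)=(-1)^k$ if $A$ is a product of $k\ge 0$ distinct primes and $\mu(A)=0$ otherwise; let $\mathcal N(A)=\{\deg P: P\text{ prime},\ P\mid A\}$ and let $\Omega(A)=\#\mathcal N(A)$ be the number of distinct degrees of primes dividing $A$. Let $\Delta_2(A)$ be the second largest element of $\mathcal N(A)$, with $\Delta_2(A)=0$ if $\Omega(A)<2$, and let $Q^{(2)}_{\mathcal S}(A)=\#\{P\in\mathcal S: P\mid A,\ \deg P=\Delta_2(A)\}$. Let $\mathcal D(\mathcal S)$ be the set of monic $A$ that have exactly one prime divisor of smallest degree (among the prime divisors of $A$), this prime divisor lying in $\mathcal S$. Then $$\lim_{x\to\infty}\ \sum_{\substack{A\text{ monic},\ 1\le\deg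 A\le x\\ A\in\mathcal D(\mathcal S)}}\frac{\mu(A)\,\Omega(A)}{q^{\deg A}}=0,$$ and $$\lim_{n\to\infty}\ \frac1{q^n}\sum_{\substack{A\text{ monic}\\ \deg A=n}}Q^{(2)}_{\mathcal S}(A)=\delta(\mathcal S).$$ -/

import Mathlib

open Polynomial Filter Topology

namespace FqT

noncomputable section

theorem finite_monic_natDegree_le (F : Type*) [Field F] [Finite F] (n : ℕ) :
    {A : F[X] | A.Monic ∧ A.natDegree ≤ n}.Finite := by
  apply Set.Finite.of_finite_image (f := fun (A : F[X]) (i : Fin (n + 1)) => A.coeff i)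
    (Set.toFinite _)
  rintro A ⟨-, hA⟩ B ⟨-, hB⟩ h
  ext i
  by_cases hi : i < n + 1
  · exact congrFun h ⟨i, hi⟩
  · rw [coeff_eq_zero_of_natDegree_lt (by omega), coeff_eq_zero_of_natDegree_lt (by omega)]

/-- The monic polynomials of degree at most `n` over a finite field. -/
def monicsUpTo (F : Type*) [Field F] [Finite F] (n : ℕ) : Finset F[X] :=
  (finite_monic_natDegree_le F n).toFinset

theorem mem_monicsUpTo {F : Type*} [Field F] [Finite F] {n : ℕ} {A : F[X]} :
    A ∈ monicsUpTo F n ↔ A.Monic ∧ A.natDegree ≤ n := by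
  simp [monicsUpTo]

/-- A prime of `F[T]` is a monic irreducible polynomial. -/
def IsPrimePoly {F : Type*} [Field F] (P : F[X]) : Prop :=
  P.Monic ∧ Irreducible P

/-- `π_S(n)`: the number of primes of degree `n` in `S`. -/
def primeCount {F : Type*} [Field F] (S : Set F[X]) (n : ℕ) : ℕ :=
  {P : F[X] | P ∈ S ∧ IsPrimePoly P ∧ P.natDegree = n}.ncard

/-- The set `S` of primes has natural density `δ`, that is, `π_S(n) / π_𝒫(n) → δ`, where `𝒫` is
the set of all primes. -/
def HasNaturalDensity {F : Type*} [Field F] (S : Set F[X]) (δ : ℝ) : Prop :=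
  Tendsto (fun n : ℕ => (primeCount S n : ℝ) / (primeCount {P : F[X] | IsPrimePoly P} n : ℝ))
    atTop (𝓝 δ)

open scoped Classical in
/-- The set of primes dividing `A` (for `A ≠ 0`). -/
def primeDivisors {F : Type*} [Field F] [Finite F] (A : F[X]) : Finset F[X] :=
  {P ∈ monicsUpTo F A.natDegree | IsPrimePoly P ∧ P ∣ A}

theorem mem_primeDivisors {F : Type*} [Field F] [Finite F] {A P : F[X]} (hA : A ≠ 0) :
    P ∈ primeDivisors A ↔ IsPrimePoly P ∧ P ∣ A := by
  simp only [primeDivisors, Finset.mem_filter, mem_monicsUpTo, and_iff_right_iff_imp]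
  exact fun h => ⟨h.1.1, natDegree_le_of_dvd h.2 hA⟩

/-- `𝒩(A)`: the set of degrees of the primes dividing `A`. -/
def primeDegrees {F : Type*} [Field F] [Finite F] (A : F[X]) : Finset ℕ :=
  (primeDivisors A).image natDegree

/-- `Ω(A)`: the number of distinct degrees of primes dividing `A`. -/
def numDegrees {F : Type*} [Field F] [Finite F] (A : F[X]) : ℕ :=
  (primeDegrees A).card

/-- `Δ_k(A)`, for `k ≥ 1`: the `k`-th largest element of `𝒩(A)`, and `0` if `k > Ω(A)`. -/
def kthLargest {F : Type*} [Field F] [Finite F] (k : ℕ) (A : F[X]) : ℕ :=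
  ((primeDegrees A).sort (· ≥ ·)).getD (k - 1) 0

/-- `δ_k(A)`, for `k ≥ 1`: the `k`-th smallest element of `𝒩(A)`, and `0` if `k > Ω(A)`. -/
def kthSmallest {F : Type*} [Field F] [Finite F] (k : ℕ) (A : F[X]) : ℕ :=
  ((primeDegrees A).sort (· ≤ ·)).getD (k - 1) 0

/-- The set of primes dividing `A` of the smallest degree. -/
def minPrimes {F : Type*} [Field F] [Finite F] (A : F[X]) : Finset F[X] :=
  {P ∈ primeDivisors A | P.natDegree = kthSmallest 1 A}

/-- `𝒟(S)`: the monic `A` with a unique prime divisor of smallest degree, this prime being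
in `S`. -/
def uniqueMinIn {F : Type*} [Field F] [Finite F] (S : Set F[X]) : Set F[X] :=
  {A | A.Monic ∧ ∃ P ∈ S, minPrimes A = {P}}

open scoped Classical in
/-- `Q_S^{(k)}(A)`: the number of primes in `S` dividing `A` of degree `Δ_k(A)`. -/
def countKthLargest {F : Type*} [Field F] [Finite F] (S : Set F[X]) (k : ℕ) (A : F[X]) : ℕ :=
  {P ∈ primeDivisors A | P ∈ S ∧ P.natDegree = kthLargest k A}.card

end

end FqT

/-!
The two limits are two sides of a duality between smallest and largest prime divisors.

For a single monic `A`, the sum of `μ(D) Ω(D)` over the divisors `D ∈ 𝒟(S)` of `A` equals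
`Q_S^{(2)}(A) - Q_S^{(1)}(A)` (`sum_dvd_moebius_mul_numDegrees`). Only squarefree `D` matter; such
a `D` is its minimal prime `P` times a set `W` of prime divisors of `A` of larger degree, and the
alternating sum of `1 + #deg W` over all `W` is `1` if `A` has no prime degree above `deg P`, is
`-1` if it has exactly one, and vanishes otherwise. Averaging over the monic `A` of degree `x`
replaces divisibility by `D` with the factor `q ^ (-deg D)`, so the partial sum of the Möbius
series up to degree `x` is exactly the difference of the mean values of `Q_S^{(2)}` and
`Q_S^{(1)}` over degree `x` (`sum_moebius_mul_numDegrees_div`). Hence everything follows once both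
mean values tend to `δ`.

The mean of `Q_S^{(k)}` over degree `n` is `∑ m, w n m * (π_S(m) / π(m))`, where the weights `w`
do not depend on `S`: a prime `P` of degree `m` counts for `A = P B` precisely when `B` has `k - 1`
prime degrees above `m` (`sum_countKthLargest_div`). By Toeplitz's lemma it is enough that, for
`k = 1, 2`, each fixed `w n m` tends to `0` and that `∑ m, w n m` tends to `1`.

* The first holds because almost every `A` has two prime degrees above `m`
  (`tendsto_card_atMostOneDegreeAbove`). By Turán's variance bound, few `A` avoid all primes
  whose degree lies in a long interval, since `∑ 1 / |P|` diverges; apply this to two disjoint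
  intervals.
* The second says that `Q^{(k)}`, for the set of all primes, has mean tending to `1`
  (`tendsto_mean_countKthLargest`). It is at least `1` for almost every `A`, and the excess is
  bounded by pairs of distinct primes of the same degree `m = Δ_k(A)`, whose mean number is
  `∑ m, O(1 / m ^ 2)` times densities that tend to `0` for each `m`; dominated convergence applies.
-/

namespace FqT

open scoped Classical

variable {F : Type*} [Field F] [Finite F]

/-! ### Monic polynomials of a given degree -/

/-- The monic polynomials of degree `n`. -/
noncomputable def monics (F : Type*) [Field F] [Finite F] (n : ℕ) : Finset F[X] :=
  {A ∈ monicsUpTo F n | A.natDegree = n}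

theorem mem_monics {n : ℕ} {A : F[X]} : A ∈ monics F n ↔ A.Monic ∧ A.natDegree = n := by
  simp only [monics, Finset.mem_filter, mem_monicsUpTo]
  exact ⟨fun h => ⟨h.1.1, h.2⟩, fun h => ⟨⟨h.1, h.2.le⟩, h.2⟩⟩

theorem card_monics (n : ℕ) : (monics F n).card = Nat.card F ^ n := by
  have e := (monicEquivDegreeLT (R := F) n).trans (degreeLTEquiv F n).toEquiv
  have h := Nat.card_congr e
  rw [Nat.card_fun, Nat.card_eq_fintype_card (α := Fin n), Fintype.card_fin] at h
  rw [← h]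
  exact (Nat.subtype_card (monics F n) fun _ => mem_monics).symm

theorem sum_monics_filter_dvd {M : Type*} [AddCommMonoid M] {n : ℕ} {D : F[X]} (hD : D.Monic)
    (hn : D.natDegree ≤ n) (f : F[X] → M) :
    ∑ A ∈ monics F n with D ∣ A, f A = ∑ B ∈ monics F (n - D.natDegree), f (D * B) := by
  symm
  refine Finset.sum_bij (fun B _ => D * B) ?_ ?_ ?_ (fun _ _ => rfl)
  · intro B hB
    rw [mem_monics] at hB
    rw [Finset.mem_filter, mem_monics, hD.natDegree_mul hB.1, hB.2]
    exact ⟨⟨hD.mul hB.1, by omega⟩, dvd_mul_right _ _⟩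
  · intro B _ B' _ h
    exact mul_left_cancel₀ hD.ne_zero h
  · intro A hA
    rw [Finset.mem_filter, mem_monics] at hA
    obtain ⟨⟨hA, hn'⟩, B, rfl⟩ := hA
    have hB : B.Monic := hD.of_mul_monic_left hA
    refine ⟨B, ?_, rfl⟩
    rw [hD.natDegree_mul hB] at hn'
    rw [mem_monics]
    exact ⟨hB, by omega⟩

theorem monics_filter_dvd_eq_empty {n : ℕ} {D : F[X]} (hn : n < D.natDegree) :
    {A ∈ monics F n | D ∣ A} = ∅ := by
  rw [Finset.filter_eq_empty_iff]
  intro A hA h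
  rw [mem_monics] at hA
  have := natDegree_le_of_dvd h hA.1.ne_zero
  omega

theorem card_monics_filter_dvd {n : ℕ} {D : F[X]} (hD : D.Monic) (hn : D.natDegree ≤ n) :
    ({A ∈ monics F n | D ∣ A}.card : ℝ) =
      (Nat.card F : ℝ) ^ n / (Nat.card F : ℝ) ^ D.natDegree := by
  have h := sum_monics_filter_dvd hD hn (fun _ => 1)
  rw [← Finset.card_eq_sum_ones, ← Finset.card_eq_sum_ones, card_monics] at h
  have h0 : (Nat.card F : ℝ) ≠ 0 := by exact_mod_cast Nat.card_pos.ne'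
  rw [h, Nat.cast_pow, pow_sub₀ _ h0 hn, div_eq_mul_inv]

/-! ### Prime divisors -/

theorem IsPrimePoly.natDegree_pos {K : Type*} [Field K] {P : K[X]} (hP : IsPrimePoly P) :
    0 < P.natDegree :=
  hP.2.natDegree_pos

theorem IsPrimePoly.eq_of_dvd {K : Type*} [Field K] {P Q : K[X]} (hP : IsPrimePoly P)
    (hQ : IsPrimePoly Q) (h : P ∣ Q) :
    P = Q :=
  eq_of_monic_of_associated hP.1 hQ.1 (hP.2.associated_of_dvd hQ.2 h)

theorem IsPrimePoly.isCoprime {K : Type*} [Field K] {P Q : K[X]} (hP : IsPrimePoly P)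
    (hQ : IsPrimePoly Q) (h : P ≠ Q) :
    IsCoprime P Q :=
  (hP.2.coprime_iff_not_dvd).2 fun hd => h (hP.eq_of_dvd hQ hd)

theorem primeDivisors_mul {A B : F[X]} (hA : A ≠ 0) (hB : B ≠ 0) :
    primeDivisors (A * B) = primeDivisors A ∪ primeDivisors B := by
  ext P
  rw [Finset.mem_union, mem_primeDivisors (mul_ne_zero hA hB), mem_primeDivisors hA,
    mem_primeDivisors hB]
  constructor
  · rintro ⟨hP, h⟩
    exact (hP.2.prime.dvd_or_dvd h).imp (fun h => ⟨hP, h⟩) (fun h => ⟨hP, h⟩)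
  · rintro (⟨hP, h⟩ | ⟨hP, h⟩)
    · exact ⟨hP, h.mul_right _⟩
    · exact ⟨hP, h.mul_left _⟩

theorem primeDivisors_of_isPrimePoly {P : F[X]} (hP : IsPrimePoly P) : primeDivisors P = {P} := by
  ext Q
  rw [mem_primeDivisors hP.2.ne_zero, Finset.mem_singleton]
  refine ⟨fun h => h.1.eq_of_dvd hP h.2, ?_⟩
  rintro rfl
  exact ⟨hP, dvd_rfl⟩

/-- A factor whose prime divisors have degree at most `m` does not affect the degrees
above `m`. -/
theorem primeDegrees_mul_filter_lt {D B : F[X]} {m : ℕ} (hD : D ≠ 0) (hB : B ≠ 0)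
    (hm : ∀ P ∈ primeDivisors D, P.natDegree ≤ m) :
    {j ∈ primeDegrees (D * B) | m < j} = {j ∈ primeDegrees B | m < j} := by
  have h : {j ∈ (primeDivisors D).image natDegree | m < j} = ∅ := by
    rw [Finset.filter_eq_empty_iff]
    intro j hj
    obtain ⟨P, hP, rfl⟩ := Finset.mem_image.1 hj
    exact (hm P hP).not_gt
  rw [primeDegrees, primeDivisors_mul hD hB, Finset.image_union, Finset.filter_union, h,
    Finset.empty_union, primeDegrees]

theorem primeDivisors_prod {U : Finset F[X]} (hU : ∀ P ∈ U, IsPrimePoly P) :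
    primeDivisors (∏ P ∈ U, P) = U := by
  ext Q
  rw [mem_primeDivisors (Finset.prod_ne_zero_iff.2 fun P hP => (hU P hP).2.ne_zero)]
  constructor
  · rintro ⟨hQ, h⟩
    obtain ⟨P, hP, hd⟩ := (hQ.2.prime.dvd_finsetProd_iff _).1 h
    rwa [hQ.eq_of_dvd (hU P hP) hd]
  · exact fun h => ⟨hU Q h, Finset.dvd_prod_of_mem _ h⟩

theorem moebius_prod {K : Type*} [Field K] {U : Finset K[X]} (hU : ∀ P ∈ U, IsPrimePoly P) :
    UniqueFactorizationMonoid.moebius (∏ P ∈ U, P) = (-1) ^ U.card := by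
  induction U using Finset.induction_on with
  | empty => simp
  | insert P U hPU ih =>
    have hP := hU P (Finset.mem_insert_self _ _)
    have hU' : ∀ Q ∈ U, IsPrimePoly Q := fun Q hQ => hU Q (Finset.mem_insert_of_mem hQ)
    have hco : IsCoprime P (∏ Q ∈ U, Q) := IsCoprime.prod_right fun Q hQ =>
      hP.isCoprime (hU' Q hQ) fun h => hPU (h ▸ hQ)
    rw [Finset.prod_insert hPU, hco.isRelPrime.moebius_mul, ih hU', hP.2.moebius_eq,
      Finset.card_insert_of_notMem hPU, pow_succ]
    ring

theorem prod_primeDivisors_dvd {A : F[X]} (hA : A ≠ 0) {U : Finset F[X]}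
    (hU : U ⊆ primeDivisors A) : ∏ P ∈ U, P ∣ A := by
  refine Finset.prod_dvd_of_coprime ?_ fun P hP => ((mem_primeDivisors hA).1 (hU hP)).2
  intro P hP Q hQ h
  exact ((mem_primeDivisors hA).1 (hU hP)).1.isCoprime ((mem_primeDivisors hA).1 (hU hQ)).1 h

theorem prod_primeDivisors {D : F[X]} (hD : D.Monic) (hs : Squarefree D) :
    ∏ P ∈ primeDivisors D, P = D := by
  obtain ⟨E, hE⟩ := prod_primeDivisors_dvd hD.ne_zero (Finset.Subset.refl (primeDivisors D))
  have hR : (∏ P ∈ primeDivisors D, P).Monic :=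
    monic_prod_of_monic _ _ fun P hP => ((mem_primeDivisors hD.ne_zero).1 hP).1.1
  have hEm : E.Monic := hR.of_mul_monic_left (hE ▸ hD)
  by_cases hu : IsUnit E
  · rw [hEm.isUnit_iff.1 hu, mul_one] at hE
    exact hE.symm
  · exfalso
    obtain ⟨Q, hQm, hQ, hQE⟩ := exists_monic_irreducible_factor E hu
    have hQD : Q ∣ D := hE ▸ hQE.mul_left _
    have hQR : Q ∣ ∏ P ∈ primeDivisors D, P :=
      Finset.dvd_prod_of_mem _ ((mem_primeDivisors hD.ne_zero).2 ⟨⟨hQm, hQ⟩, hQD⟩)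
    exact hQ.not_isUnit (hs Q (hE ▸ mul_dvd_mul hQR hQE))

/-! ### Alternating sums over subsets of a graded finite set -/

section Combinatorics

variable {α : Type*}

theorem sum_powerset_neg_one_pow_mul_one_add_card_image (V : Finset α) (f : α → ℕ) :
    ∑ U ∈ V.powerset, (-1 : ℤ) ^ U.card * (1 + (U.image f).card) =
      (if (V.image f).card = 0 then 1 else 0) - (if (V.image f).card = 1 then 1 else 0) := by
  -- Count the values of `f` on `U` one at a time.
  have hcard : ∀ U ∈ V.powerset, ((U.image f).card : ℤ) =
      ∑ j ∈ V.image f, (1 - if U ⊆ {P ∈ V | f P ≠ j} then (1 : ℤ) else 0) := by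
    intro U hU
    rw [Finset.mem_powerset] at hU
    have : U.image f = {j ∈ V.image f | ¬ U ⊆ {P ∈ V | f P ≠ j}} := by
      ext j
      simp only [Finset.mem_image, Finset.mem_filter, Finset.subset_iff, not_forall]
      constructor
      · rintro ⟨P, hP, rfl⟩
        exact ⟨⟨P, hU hP, rfl⟩, P, hP, by simp⟩
      · rintro ⟨-, P, hP, h⟩
        refine ⟨P, hP, ?_⟩
        by_contra h'
        exact h ⟨hU hP, h'⟩
    rw [this, Finset.card_filter, Nat.cast_sum]
    refine Finset.sum_congr rfl fun j _ => ?_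
    split_ifs <;> simp
  have hsub : ∀ j, ∑ U ∈ V.powerset,
      (-1 : ℤ) ^ U.card * (if U ⊆ {P ∈ V | f P ≠ j} then (1 : ℤ) else 0) =
        if {P ∈ V | f P ≠ j} = ∅ then 1 else 0 := by
    intro j
    rw [← Finset.sum_powerset_neg_one_pow_card]
    simp only [mul_ite, mul_one, mul_zero]
    rw [← Finset.sum_filter]
    refine Finset.sum_congr ?_ fun _ _ => rfl
    ext U
    simp only [Finset.mem_filter, Finset.mem_powerset, and_iff_right_iff_imp]
    exact fun h => h.trans (Finset.filter_subset _ _)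
  calc ∑ U ∈ V.powerset, (-1 : ℤ) ^ U.card * (1 + (U.image f).card)
      = ∑ U ∈ V.powerset, ((-1 : ℤ) ^ U.card + ∑ j ∈ V.image f, ((-1 : ℤ) ^ U.card -
          (-1 : ℤ) ^ U.card * (if U ⊆ {P ∈ V | f P ≠ j} then (1 : ℤ) else 0))) := by
        refine Finset.sum_congr rfl fun U hU => ?_
        rw [hcard U hU, mul_add, mul_one, Finset.mul_sum]
        simp only [mul_sub, mul_one]
    _ = (if V = ∅ then 1 else 0) + ∑ j ∈ V.image f, ((if V = ∅ then 1 else 0) -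
          if {P ∈ V | f P ≠ j} = ∅ then 1 else 0) := by
        rw [Finset.sum_add_distrib, Finset.sum_comm, Finset.sum_powerset_neg_one_pow_card]
        congr 1
        refine Finset.sum_congr rfl fun j _ => ?_
        rw [Finset.sum_sub_distrib, hsub, Finset.sum_powerset_neg_one_pow_card]
    _ = _ := by
        rcases Finset.eq_empty_or_nonempty V with rfl | hV
        · simp
        · have h0 : (V.image f).card ≠ 0 := by
            rw [Finset.card_ne_zero]; exact hV.image f
          have hiff : ∀ j ∈ V.image f, ({P ∈ V | f P ≠ j} = ∅ ↔ V.image f = {j}) := by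
            intro j hj
            rw [Finset.filter_eq_empty_iff, Finset.eq_singleton_iff_unique_mem]
            simp only [not_not, Finset.mem_image, forall_exists_index, and_imp,
              forall_apply_eq_imp_iff₂]
            exact ⟨fun h => ⟨Finset.mem_image.1 hj, fun P hP => h hP⟩, fun h P hP => h.2 hP⟩
          rw [if_neg hV.ne_empty, if_neg h0, zero_add, zero_sub]
          simp only [zero_sub, Finset.sum_neg_distrib, neg_inj]
          rw [Finset.sum_congr rfl fun j hj => if_congr (hiff j hj) rfl rfl]
          split_ifs with h1
          · obtain ⟨i, hi⟩ := Finset.card_eq_one.1 h1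
            simp [hi]
          · refine Finset.sum_eq_zero fun j _ => if_neg fun h => h1 ?_
            rw [h, Finset.card_singleton]

/-- The combinatorial form of the duality. A set `U` with a strictly minimal element `P` is
`insert P W` for a set `W` of elements above `P`, so that the sum over `U` splits according
to `P`. -/
theorem sum_powerset_filter_unique_min (V : Finset α) (f : α → ℕ) (S : Set α) :
    ∑ U ∈ V.powerset with ∃ P ∈ S, P ∈ U ∧ ∀ Q ∈ U, Q ≠ P → f P < f Q,
      (-1 : ℤ) ^ U.card * (U.image f).card =
    ∑ P ∈ V with P ∈ S, ((if {j ∈ V.image f | f P < j}.card = 1 then 1 else 0) -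
      (if {j ∈ V.image f | f P < j}.card = 0 then 1 else 0)) := by
  have himage : ∀ P, {j ∈ V.image f | f P < j} = {Q ∈ V | f P < f Q}.image f := by
    intro P
    rw [Finset.filter_image]
  have hrhs : ∀ P ∈ ({P ∈ V | P ∈ S} : Finset α),
      ((if {j ∈ V.image f | f P < j}.card = 1 then 1 else 0) -
        (if {j ∈ V.image f | f P < j}.card = 0 then 1 else 0) : ℤ) =
      ∑ W ∈ {Q ∈ V | f P < f Q}.powerset,
        (-1 : ℤ) ^ (insert P W).card * ((insert P W).image f).card := by
    intro P _
    have h := sum_powerset_neg_one_pow_mul_one_add_card_image {Q ∈ V | f P < f Q} f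
    rw [himage, ← neg_sub, ← h, ← Finset.sum_neg_distrib]
    refine Finset.sum_congr rfl fun W hW => ?_
    have hlt : ∀ Q ∈ W, f P < f Q := fun Q hQ =>
      (Finset.mem_filter.1 (Finset.mem_powerset.1 hW hQ)).2
    have hP : P ∉ W := fun h => lt_irrefl _ (hlt P h)
    have hfP : f P ∉ W.image f := by
      rw [Finset.mem_image]
      rintro ⟨Q, hQ, h⟩
      exact (hlt Q hQ).ne' h
    rw [Finset.image_insert, Finset.card_insert_of_notMem hP, Finset.card_insert_of_notMem hfP]
    push_cast
    ring
  rw [Finset.sum_congr rfl hrhs, Finset.sum_sigma']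
  symm
  refine Finset.sum_bij (fun x _ => insert x.1 x.2) ?_ ?_ ?_ (fun _ _ => rfl)
  · rintro ⟨P, W⟩ h
    simp only [Finset.mem_sigma, Finset.mem_filter, Finset.mem_powerset] at h ⊢
    obtain ⟨⟨hPV, hPS⟩, hW⟩ := h
    refine ⟨Finset.insert_subset hPV (hW.trans (Finset.filter_subset _ _)), P, hPS,
      Finset.mem_insert_self _ _, fun Q hQ hne => ?_⟩
    exact (Finset.mem_filter.1 (hW ((Finset.mem_insert.1 hQ).resolve_left hne))).2
  · rintro ⟨P, W⟩ h ⟨P', W'⟩ h' heq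
    simp only [Finset.mem_sigma, Finset.mem_filter, Finset.mem_powerset] at h h' heq
    have hW : ∀ Q ∈ W, f P < f Q := fun Q hQ => (Finset.mem_filter.1 (h.2 hQ)).2
    have hW' : ∀ Q ∈ W', f P' < f Q := fun Q hQ => (Finset.mem_filter.1 (h'.2 hQ)).2
    have hPP : P = P' := by
      by_contra hne
      have h1 : P ∈ W' := (Finset.mem_insert.1 (heq ▸ Finset.mem_insert_self P W)).resolve_left hne
      have h2 : P' ∈ W :=
        (Finset.mem_insert.1 (heq.symm ▸ Finset.mem_insert_self P' W')).resolve_left (Ne.symm hne)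
      exact lt_asymm (hW _ h2) (hW' _ h1)
    subst hPP
    have h1 : P ∉ W := fun h => lt_irrefl _ (hW P h)
    have h2 : P ∉ W' := fun h => lt_irrefl _ (hW' P h)
    rw [← Finset.erase_insert h1, ← Finset.erase_insert h2, heq]
  · intro U hU
    simp only [Finset.mem_filter, Finset.mem_powerset] at hU
    obtain ⟨hUV, P, hPS, hPU, hmin⟩ := hU
    refine ⟨⟨P, U.erase P⟩, ?_, Finset.insert_erase hPU⟩
    simp only [Finset.mem_sigma, Finset.mem_filter, Finset.mem_powerset]
    refine ⟨⟨hUV hPU, hPS⟩, fun Q hQ => ?_⟩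
    rw [Finset.mem_erase] at hQ
    exact Finset.mem_filter.2 ⟨hUV hQ.2, hmin Q hQ.2 hQ.1⟩

theorem getD_eq_iff_countP {l : List ℕ} (hl : l.Pairwise (· > ·)) {a : ℕ} (ha : a ∈ l)
    (h0 : 0 < a) (k : ℕ) : l.getD k 0 = a ↔ l.countP (a < ·) = k := by
  induction l generalizing k with
  | nil => simp at ha
  | cons b t ih =>
    rw [List.pairwise_cons] at hl
    rcases List.mem_cons.1 ha with rfl | hat
    · have hc : t.countP (a < ·) = 0 := by
        rw [List.countP_eq_zero]
        intro x hx
        have := hl.1 x hx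
        simp only [decide_eq_true_eq]
        omega
      rw [List.countP_cons_of_neg (by simp), hc]
      cases k with
      | zero => simp
      | succ k =>
        rw [List.getD_cons_succ]
        refine iff_of_false (fun h => ?_) (by omega)
        rcases lt_or_ge k t.length with hk | hk
        · rw [List.getD_eq_getElem _ _ hk] at h
          have := hl.1 _ (List.getElem_mem hk)
          omega
        · rw [List.getD_eq_default _ _ hk] at h
          omega
    · have hb : b > a := hl.1 a hat
      rw [List.countP_cons_of_pos (by simpa using hb)]
      cases k with
      | zero =>
        rw [List.getD_cons_zero]
        exact iff_of_false (by omega) (by omega)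
      | succ k =>
        rw [List.getD_cons_succ, ih hl.2 hat]
        omega

theorem sort_getD_eq_iff (s : Finset ℕ) {a : ℕ} (ha : a ∈ s) (h0 : 0 < a) (k : ℕ) :
    (s.sort (· ≥ ·)).getD k 0 = a ↔ {j ∈ s | a < j}.card = k := by
  have hp : (s.sort (· ≥ ·)).Pairwise (· > ·) := (Finset.sortedGT_sort s).pairwise
  rw [getD_eq_iff_countP hp ((Finset.mem_sort _).2 ha) h0, List.countP_eq_length_filter]
  have hn : ((s.sort (· ≥ ·)).filter (a < ·)).Nodup := (Finset.sort_nodup _ _).filter _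
  rw [← List.toFinset_card_of_nodup hn, List.toFinset_filter, Finset.sort_toFinset]
  simp

end Combinatorics

/-! ### The degrees `Δ_k` and `δ_1` -/

theorem natDegree_eq_kthLargest_iff {A P : F[X]} (hA : A ≠ 0) (hP : P ∈ primeDivisors A) (k : ℕ) :
    P.natDegree = kthLargest (k + 1) A ↔ {j ∈ primeDegrees A | P.natDegree < j}.card = k := by
  rw [eq_comm, kthLargest, Nat.add_sub_cancel]
  exact sort_getD_eq_iff _ (Finset.mem_image_of_mem _ hP)
    ((mem_primeDivisors hA).1 hP).1.natDegree_pos k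

theorem countKthLargest_eq {A : F[X]} (hA : A ≠ 0) (S : Set F[X]) (k : ℕ) :
    countKthLargest S (k + 1) A = {P ∈ primeDivisors A | P ∈ S ∧
      {j ∈ primeDegrees A | P.natDegree < j}.card = k}.card := by
  rw [countKthLargest]
  congr 1
  refine Finset.filter_congr fun P hP => ?_
  rw [natDegree_eq_kthLargest_iff hA hP]

theorem exists_natDegree_eq_kthLargest {A : F[X]} {k : ℕ} (hk : k < numDegrees A) :
    ∃ P ∈ primeDivisors A, P.natDegree = kthLargest (k + 1) A := by
  have hk' : k < ((primeDegrees A).sort (· ≥ ·)).length := by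
    rwa [Finset.length_sort]
  have h : kthLargest (k + 1) A ∈ primeDegrees A := by
    rw [kthLargest, Nat.add_sub_cancel, List.getD_eq_getElem _ _ hk', ← Finset.mem_sort (· ≥ ·)]
    exact List.getElem_mem hk'
  exact Finset.mem_image.1 h

theorem kthSmallest_one_mem {A : F[X]} (h : (primeDegrees A).Nonempty) :
    kthSmallest 1 A ∈ primeDegrees A ∧ ∀ j ∈ primeDegrees A, kthSmallest 1 A ≤ j := by
  have hs : 0 < ((primeDegrees A).sort (· ≤ ·)).length := by
    rw [Finset.length_sort]; exact h.card_pos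
  have : kthSmallest 1 A = (primeDegrees A).min' h := by
    rw [kthSmallest, List.getD_eq_getElem _ _ hs]
    exact Finset.sorted_zero_eq_min'
  rw [this]
  exact ⟨Finset.min'_mem _ _, fun j hj => Finset.min'_le _ _ hj⟩

theorem minPrimes_eq_singleton_iff {A P : F[X]} :
    minPrimes A = {P} ↔
      P ∈ primeDivisors A ∧ ∀ Q ∈ primeDivisors A, Q ≠ P → P.natDegree < Q.natDegree := by
  constructor
  · intro h
    have hP : P ∈ minPrimes A := h ▸ Finset.mem_singleton_self P
    obtain ⟨hP, hd⟩ := Finset.mem_filter.1 hP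
    refine ⟨hP, fun Q hQ hne => ?_⟩
    have hle := (kthSmallest_one_mem ⟨_, Finset.mem_image_of_mem natDegree hP⟩).2 _
      (Finset.mem_image_of_mem natDegree hQ)
    refine lt_of_le_of_ne (hd ▸ hle) fun heq => hne ?_
    have : Q ∈ minPrimes A := Finset.mem_filter.2 ⟨hQ, by rw [← heq, hd]⟩
    rwa [h, Finset.mem_singleton] at this
  · rintro ⟨hP, hmin⟩
    obtain ⟨hmem, hle⟩ := kthSmallest_one_mem ⟨_, Finset.mem_image_of_mem natDegree hP⟩
    obtain ⟨R, hR, hRd⟩ := Finset.mem_image.1 hmem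
    have hRP : R = P := by
      by_contra hne
      have h1 := hmin R hR hne
      have h2 := hle _ (Finset.mem_image_of_mem natDegree hP)
      omega
    rw [Finset.eq_singleton_iff_unique_mem]
    refine ⟨Finset.mem_filter.2 ⟨hP, hRP ▸ hRd⟩, fun Q hQ => ?_⟩
    obtain ⟨hQ, hQd⟩ := Finset.mem_filter.1 hQ
    by_contra hne
    have := hmin Q hQ hne
    rw [hQd, ← hRd, hRP] at this
    exact lt_irrefl _ this

/-! ### The duality identity -/

/-- The duality between smallest and largest prime divisors, for a single polynomial. -/
theorem sum_dvd_moebius_mul_numDegrees {A : F[X]} (hA : A.Monic) {n : ℕ} (hn : A.natDegree = n)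
    (S : Set F[X]) :
    ∑ D ∈ monicsUpTo F n with (1 ≤ D.natDegree ∧ D ∈ uniqueMinIn S) ∧ D ∣ A,
      UniqueFactorizationMonoid.moebius D * (numDegrees D : ℤ) =
    countKthLargest S 2 A - countKthLargest S 1 A := by
  have hV : ∀ U ⊆ primeDivisors A, ∀ P ∈ U, IsPrimePoly P := fun U hU P hP =>
    ((mem_primeDivisors hA.ne_zero).1 (hU hP)).1
  have key := sum_powerset_filter_unique_min (primeDivisors A) natDegree S
  rw [Finset.sum_sub_distrib, ← Finset.sum_filter, ← Finset.sum_filter, Finset.sum_const,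
    Finset.sum_const, Finset.filter_filter, Finset.filter_filter, nsmul_one, nsmul_one] at key
  rw [countKthLargest_eq hA.ne_zero S 1, countKthLargest_eq hA.ne_zero S 0]
  refine Eq.trans ?_ key
  symm
  refine Finset.sum_of_injOn (fun U => ∏ P ∈ U, P) ?_ ?_ ?_ ?_
  · intro U hU U' hU' h
    rw [Finset.mem_coe, Finset.mem_filter, Finset.mem_powerset] at hU hU'
    have := congrArg primeDivisors h
    simpa only [primeDivisors_prod (hV U hU.1), primeDivisors_prod (hV U' hU'.1)] using this
  · intro U hU
    rw [Finset.mem_coe, Finset.mem_filter, Finset.mem_powerset] at hU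
    obtain ⟨hUA, P, hPS, hPU, hmin⟩ := hU
    have hdvd := prod_primeDivisors_dvd hA.ne_zero hUA
    have hm : (∏ P ∈ U, P).Monic := monic_prod_of_monic _ _ fun P hP => (hV U hUA P hP).1
    rw [Finset.mem_coe, Finset.mem_filter, mem_monicsUpTo]
    refine ⟨⟨hm, hn ▸ natDegree_le_of_dvd hdvd hA.ne_zero⟩, ⟨?_, hm, P, hPS, ?_⟩, hdvd⟩
    · exact (hV U hUA P hPU).natDegree_pos.trans_le
        (natDegree_le_of_dvd (Finset.dvd_prod_of_mem _ hPU) hm.ne_zero)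
    · rw [minPrimes_eq_singleton_iff, primeDivisors_prod (hV U hUA)]
      exact ⟨hPU, hmin⟩
  · intro D hD hnot
    rw [Finset.mem_filter, mem_monicsUpTo] at hD
    obtain ⟨⟨hDm, -⟩, ⟨-, -, P, hPS, hmin⟩, hDA⟩ := hD
    -- The divisors that are not hit are not squarefree.
    rw [UniqueFactorizationMonoid.moebius_of_not_squarefree, zero_mul]
    intro hs
    refine hnot ⟨primeDivisors D, ?_, prod_primeDivisors hDm hs⟩
    rw [Finset.mem_coe, Finset.mem_filter, Finset.mem_powerset]
    refine ⟨fun Q hQ => ?_, P, hPS, minPrimes_eq_singleton_iff.1 hmin⟩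
    rw [mem_primeDivisors hDm.ne_zero] at hQ
    exact (mem_primeDivisors hA.ne_zero).2 ⟨hQ.1, hQ.2.trans hDA⟩
  · intro U hU
    rw [Finset.mem_filter, Finset.mem_powerset] at hU
    rw [moebius_prod (hV U hU.1), numDegrees, primeDegrees, primeDivisors_prod (hV U hU.1)]

/-- The duality on average: the partial sums of the Möbius series are differences of mean values
of `Q^{(2)}_S` and `Q^{(1)}_S`. -/
theorem sum_moebius_mul_numDegrees_div (S : Set F[X]) (n : ℕ) :
    ∑ D ∈ monicsUpTo F n with 1 ≤ D.natDegree ∧ D ∈ uniqueMinIn S,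
      ((UniqueFactorizationMonoid.moebius D : ℤ) : ℝ) * (numDegrees D : ℝ)
        / (Nat.card F : ℝ) ^ D.natDegree =
    (∑ A ∈ monics F n, (countKthLargest S 2 A : ℝ)) / (Nat.card F : ℝ) ^ n -
      (∑ A ∈ monics F n, (countKthLargest S 1 A : ℝ)) / (Nat.card F : ℝ) ^ n := by
  have h0 : (Nat.card F : ℝ) ≠ 0 := by exact_mod_cast Nat.card_pos.ne'
  rw [← sub_div, ← Finset.sum_sub_distrib, eq_div_iff (pow_ne_zero _ h0), Finset.sum_mul]
  have hpt : ∀ A ∈ monics F n, (countKthLargest S 2 A : ℝ) - (countKthLargest S 1 A : ℝ) =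
      ∑ D ∈ monicsUpTo F n with 1 ≤ D.natDegree ∧ D ∈ uniqueMinIn S,
        if D ∣ A then ((UniqueFactorizationMonoid.moebius D : ℤ) : ℝ) * (numDegrees D : ℝ)
          else 0 := by
    intro A hA
    rw [mem_monics] at hA
    have h := congrArg (fun z : ℤ => (z : ℝ)) (sum_dvd_moebius_mul_numDegrees hA.1 hA.2 S)
    push_cast at h
    rw [← h, ← Finset.sum_filter, Finset.filter_filter]
  rw [Finset.sum_congr rfl hpt, Finset.sum_comm]
  refine Finset.sum_congr rfl fun D hD => ?_
  rw [Finset.mem_filter, mem_monicsUpTo] at hD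
  rw [← Finset.sum_filter, Finset.sum_const, nsmul_eq_mul,
    card_monics_filter_dvd hD.1.1 hD.1.2]
  ring

/-! ### Counting primes -/

/-- The primes of degree `j`. -/
noncomputable def primesOfDegree (F : Type*) [Field F] [Finite F] (j : ℕ) : Finset F[X] :=
  {P ∈ monics F j | IsPrimePoly P}

theorem mem_primesOfDegree {j : ℕ} {P : F[X]} :
    P ∈ primesOfDegree F j ↔ IsPrimePoly P ∧ P.natDegree = j := by
  rw [primesOfDegree, Finset.mem_filter, mem_monics]
  exact ⟨fun h => ⟨h.2, h.1.2⟩, fun h => ⟨⟨h.1.1, h.2⟩, h.1⟩⟩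

theorem primeCount_eq_card (S : Set F[X]) (j : ℕ) :
    primeCount S j = {P ∈ primesOfDegree F j | P ∈ S}.card := by
  rw [primeCount, ← Set.ncard_coe_finset]
  congr 1
  ext P
  simp only [Set.mem_ofPred_eq, Finset.coe_filter, mem_primesOfDegree]
  tauto

theorem primeCount_setOf_isPrimePoly (j : ℕ) :
    primeCount {P : F[X] | IsPrimePoly P} j = (primesOfDegree F j).card := by
  rw [primeCount_eq_card]
  congr 1
  exact Finset.filter_true_of_mem fun P hP => (mem_primesOfDegree.1 hP).1

theorem primeCount_le_card (S : Set F[X]) (j : ℕ) :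
    primeCount S j ≤ (primesOfDegree F j).card := by
  rw [primeCount_eq_card]
  exact Finset.card_filter_le _ _

/-- Gauss's formula, from the factorization of `X ^ q ^ n - X`. -/
theorem sum_divisors_mul_card_primesOfDegree {n : ℕ} (hn : n ≠ 0) :
    ∑ d ∈ n.divisors, d * (primesOfDegree F d).card = Nat.card F ^ n := by
  have hq : 1 < Nat.card F := Finite.one_lt_card
  have hdeg : (X ^ Nat.card F ^ n - X : F[X]).natDegree = Nat.card F ^ n :=
    FiniteField.X_pow_card_pow_sub_X_natDegree_eq F hn hq
  have hm : (X ^ Nat.card F ^ n - X : F[X]).Monic := by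
    refine monic_X_pow_sub ?_
    rw [degree_X]
    exact_mod_cast Nat.one_lt_pow hn hq
  have hs : Squarefree (X ^ Nat.card F ^ n - X : F[X]) := by
    obtain ⟨p, hp⟩ := CharP.exists F
    have := Fintype.ofFinite F
    have hdvd : p ∣ Nat.card F := by
      rw [← CharP.cast_eq_zero_iff F p, Nat.card_eq_fintype_card]
      exact Nat.cast_card_eq_zero F
    exact (galois_poly_separable p _ (dvd_pow hdvd hn)).squarefree
  have hprod := congrArg natDegree (prod_primeDivisors hm hs)
  have hmem : ∀ P : F[X], P ∈ primeDivisors (X ^ Nat.card F ^ n - X : F[X]) ↔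
      IsPrimePoly P ∧ P.natDegree ∣ n := by
    intro P
    rw [mem_primeDivisors hm.ne_zero]
    exact and_congr_right fun hP => hP.2.natDegree_dvd_iff_dvd_X_pow_card_pow_sub_X.symm
  rw [hdeg, natDegree_prod_of_monic _ _ fun P hP => ((hmem P).1 hP).1.1] at hprod
  rw [← hprod, ← Finset.sum_fiberwise_of_maps_to (g := natDegree) (t := n.divisors)
    fun P hP => Nat.mem_divisors.2 ⟨((hmem P).1 hP).2, hn⟩]
  refine Finset.sum_congr rfl fun d hd => ?_
  have : {P ∈ primeDivisors (X ^ Nat.card F ^ n - X : F[X]) | P.natDegree = d} =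
      primesOfDegree F d := by
    ext P
    rw [Finset.mem_filter, hmem, mem_primesOfDegree]
    constructor
    · exact fun h => ⟨h.1.1, h.2⟩
    · rintro ⟨hP, rfl⟩
      exact ⟨⟨hP, Nat.dvd_of_mem_divisors hd⟩, rfl⟩
  rw [this, Finset.sum_congr rfl fun P hP => (mem_primesOfDegree.1 hP).2, Finset.sum_const,
    smul_eq_mul, mul_comm]

theorem mul_card_primesOfDegree_le (n : ℕ) :
    n * (primesOfDegree F n).card ≤ Nat.card F ^ n := by
  rcases eq_or_ne n 0 with rfl | hn
  · simp
  rw [← sum_divisors_mul_card_primesOfDegree hn]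
  exact Finset.single_le_sum (f := fun d => d * (primesOfDegree F d).card)
    (fun _ _ => Nat.zero_le _) (Nat.mem_divisors_self n hn)

theorem pow_le_two_mul_mul_card_primesOfDegree {n : ℕ} (hn : 3 ≤ n) :
    Nat.card F ^ n ≤ 2 * (n * (primesOfDegree F n).card) := by
  have hq : 2 ≤ Nat.card F := Finite.one_lt_card
  have h := sum_divisors_mul_card_primesOfDegree (F := F) (n := n) (by omega)
  rw [← Nat.cons_self_properDivisors (by omega), Finset.sum_cons] at h
  -- A proper divisor of `n` is at most `n / 2`, hence less than `n - 1`.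
  have h1 : ∑ d ∈ n.properDivisors, d * (primesOfDegree F d).card < Nat.card F ^ (n - 1) := by
    refine (Finset.sum_le_sum fun d _ => mul_card_primesOfDegree_le d).trans_lt
      (Nat.geomSum_lt hq fun d hd => ?_)
    obtain ⟨⟨c, hc⟩, hlt⟩ := Nat.mem_properDivisors.1 hd
    have hc2 : 2 ≤ c := by
      by_contra hlt2
      interval_cases c <;> omega
    have : d * 2 ≤ d * c := Nat.mul_le_mul_left d hc2
    omega
  have h2 : 2 * Nat.card F ^ (n - 1) ≤ Nat.card F ^ n := by
    obtain ⟨k, rfl⟩ : ∃ k, n = k + 1 := ⟨n - 1, by omega⟩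
    rw [Nat.add_sub_cancel, pow_succ, mul_comm]
    exact Nat.mul_le_mul_left _ hq
  omega

/-- The proportion of primes among the monic polynomials of degree `j`. -/
noncomputable def primeProportion (F : Type*) [Field F] [Finite F] (j : ℕ) : ℝ :=
  (primesOfDegree F j).card / (Nat.card F : ℝ) ^ j

theorem primeProportion_nonneg (j : ℕ) : 0 ≤ primeProportion F j := by
  unfold primeProportion; positivity

theorem primeProportion_le (j : ℕ) : primeProportion F j ≤ 1 / j := by
  have hq : (0 : ℝ) < (Nat.card F : ℝ) ^ j := pow_pos (by exact_mod_cast Nat.card_pos) _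
  rcases Nat.eq_zero_or_pos j with rfl | hj
  · have : primesOfDegree F 0 = ∅ := Finset.eq_empty_of_forall_notMem fun P hP => by
      rw [mem_primesOfDegree] at hP
      exact hP.1.natDegree_pos.ne' hP.2
    simp [primeProportion, this]
  have hj' : (0 : ℝ) < j := by exact_mod_cast hj
  rw [primeProportion, div_le_div_iff₀ hq hj', one_mul, mul_comm]
  exact_mod_cast mul_card_primesOfDegree_le (F := F) j

theorem le_primeProportion {j : ℕ} (hj : 3 ≤ j) : 1 / (2 * j : ℝ) ≤ primeProportion F j := by
  have hq : (0 : ℝ) < (Nat.card F : ℝ) ^ j := pow_pos (by exact_mod_cast Nat.card_pos) _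
  have hj' : (0 : ℝ) < 2 * j := by
    have : (0 : ℝ) < j := by exact_mod_cast (by omega : 0 < j)
    linarith
  have h := pow_le_two_mul_mul_card_primesOfDegree (F := F) hj
  rw [primeProportion, div_le_div_iff₀ hj' hq, one_mul]
  have h' : (Nat.card F : ℝ) ^ j ≤ 2 * (j * (primesOfDegree F j).card) := by exact_mod_cast h
  linarith

/-- The sum of the reciprocals of the norms of the primes diverges. -/
theorem tendsto_sum_range_primeProportion :
    Tendsto (fun n => ∑ j ∈ Finset.range n, primeProportion F j) atTop atTop := by
  rw [← not_summable_iff_tendsto_nat_atTop_of_nonneg primeProportion_nonneg]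
  intro h
  have h2 : Summable fun j : ℕ => 1 / (2 * j : ℝ) := by
    refine Summable.of_norm_bounded_eventually_nat h ?_
    filter_upwards [eventually_ge_atTop 3] with j hj
    rw [Real.norm_of_nonneg (by positivity)]
    exact le_primeProportion hj
  refine Real.not_summable_one_div_natCast ((h2.mul_left 2).congr fun j => ?_)
  rw [one_div, one_div, mul_inv, ← mul_assoc, mul_inv_cancel₀ two_ne_zero, one_mul]

theorem exists_le_sum_Ico_primeProportion (a : ℕ) (C : ℝ) :
    ∃ b, C ≤ ∑ j ∈ Finset.Ico a b, primeProportion F j := by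
  obtain ⟨b, hab, hb⟩ := ((eventually_ge_atTop a).and
    ((tendsto_sum_range_primeProportion (F := F)).eventually_ge_atTop
      (C + ∑ j ∈ Finset.range a, primeProportion F j))).exists
  refine ⟨b, ?_⟩
  rw [Finset.sum_Ico_eq_sub _ hab]
  linarith

/-! ### A sieve bound by the second moment -/

/-- The monic polynomials of degree `n` without prime divisors of degree in `[a, b)`. -/
noncomputable def sifted (F : Type*) [Field F] [Finite F] (a b n : ℕ) : Finset F[X] :=
  {A ∈ monics F n | ∀ j ∈ primeDegrees A, j ∉ Finset.Ico a b}

/-- Turán's variance bound, in the form of an upper bound sieve. -/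
theorem card_sifted_mul_le {a b n : ℕ} (hn : 2 * b ≤ n) :
    (sifted F a b n).card * ∑ j ∈ Finset.Ico a b, primeProportion F j ≤ (Nat.card F : ℝ) ^ n := by
  set q : ℝ := ((Nat.card F : ℕ) : ℝ) with hqdef
  have hq : 0 < q := Nat.cast_pos.2 Nat.card_pos
  set L := ∑ j ∈ Finset.Ico a b, primeProportion F j with hL
  have hL0 : 0 ≤ L := Finset.sum_nonneg fun j _ => primeProportion_nonneg j
  set I : Finset F[X] := (Finset.Ico a b).biUnion (primesOfDegree F) with hI
  have hmem : ∀ P, P ∈ I ↔ IsPrimePoly P ∧ a ≤ P.natDegree ∧ P.natDegree < b := by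
    intro P
    simp only [hI, Finset.mem_biUnion, Finset.mem_Ico, mem_primesOfDegree]
    constructor
    · rintro ⟨j, hj, hP, rfl⟩
      exact ⟨hP, hj⟩
    · exact fun h => ⟨_, h.2, h.1, rfl⟩
  have hLI : ∑ P ∈ I, 1 / q ^ P.natDegree = L := by
    rw [hI, Finset.sum_biUnion]
    · refine Finset.sum_congr rfl fun j _ => ?_
      rw [Finset.sum_congr rfl fun P hP => by rw [(mem_primesOfDegree.1 hP).2], Finset.sum_const,
        nsmul_eq_mul, mul_one_div, primeProportion]
    · intro i _ j _ hij
      exact Finset.disjoint_left.2 fun P hi hj =>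
        hij ((mem_primesOfDegree.1 hi).2.symm.trans (mem_primesOfDegree.1 hj).2)
  set w : F[X] → ℝ := fun A => ∑ P ∈ I, if P ∣ A then 1 else 0 with hw
  have hsum1 : ∑ A ∈ monics F n, w A = q ^ n * L := by
    rw [Finset.sum_comm, ← hLI, Finset.mul_sum]
    refine Finset.sum_congr rfl fun P hP => ?_
    obtain ⟨hP, -, hb⟩ := (hmem P).1 hP
    rw [Finset.sum_boole, card_monics_filter_dvd hP.1 (by omega), mul_one_div]
  have hsum2 : ∑ A ∈ monics F n, w A ^ 2 ≤ q ^ n * (L ^ 2 + L) := by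
    have hsq : ∀ A, w A ^ 2 = ∑ P ∈ I, ∑ Q ∈ I, if P ∣ A ∧ Q ∣ A then (1 : ℝ) else 0 := by
      intro A
      rw [sq, hw, Finset.sum_mul_sum]
      refine Finset.sum_congr rfl fun P _ => Finset.sum_congr rfl fun Q _ => ?_
      by_cases h1 : P ∣ A <;> by_cases h2 : Q ∣ A <;> simp [h1, h2]
    have hpair : ∀ P ∈ I, ∀ Q ∈ I, ∑ A ∈ monics F n, (if P ∣ A ∧ Q ∣ A then (1 : ℝ) else 0) ≤
        q ^ n * (1 / q ^ P.natDegree * (1 / q ^ Q.natDegree) +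
          if P = Q then 1 / q ^ P.natDegree else 0) := by
      intro P hP Q hQ
      obtain ⟨hP, -, hPb⟩ := (hmem P).1 hP
      obtain ⟨hQ, -, hQb⟩ := (hmem Q).1 hQ
      rw [Finset.sum_boole]
      split_ifs with h
      · subst h
        simp only [and_self]
        rw [card_monics_filter_dvd hP.1 (by omega), mul_add, mul_one_div (q ^ n)]
        have : 0 ≤ q ^ n * (1 / q ^ P.natDegree * (1 / q ^ P.natDegree)) := by positivity
        linarith
      · have hd : (P * Q).natDegree = P.natDegree + Q.natDegree := hP.1.natDegree_mul hQ.1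
        have heq : {A ∈ monics F n | P ∣ A ∧ Q ∣ A} = {A ∈ monics F n | P * Q ∣ A} :=
          Finset.filter_congr fun A _ => ⟨fun hA => (hP.isCoprime hQ h).mul_dvd hA.1 hA.2,
            fun hA => ⟨(dvd_mul_right _ _).trans hA, (dvd_mul_left _ _).trans hA⟩⟩
        rw [heq, card_monics_filter_dvd (hP.1.mul hQ.1) (by omega), hd, pow_add, add_zero,
          one_div_mul_one_div, mul_one_div]
    calc ∑ A ∈ monics F n, w A ^ 2
        = ∑ P ∈ I, ∑ Q ∈ I, ∑ A ∈ monics F n, (if P ∣ A ∧ Q ∣ A then (1 : ℝ) else 0) := by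
          rw [Finset.sum_congr rfl fun A _ => hsq A, Finset.sum_comm]
          exact Finset.sum_congr rfl fun P _ => Finset.sum_comm
      _ ≤ ∑ P ∈ I, ∑ Q ∈ I, q ^ n * (1 / q ^ P.natDegree * (1 / q ^ Q.natDegree) +
          if P = Q then 1 / q ^ P.natDegree else 0) :=
          Finset.sum_le_sum fun P hP => Finset.sum_le_sum fun Q hQ => hpair P hP Q hQ
      _ = q ^ n * (L ^ 2 + L) := by
          rw [sq, ← hLI, Finset.sum_mul_sum, ← Finset.sum_add_distrib, Finset.mul_sum]
          refine Finset.sum_congr rfl fun P hP => ?_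
          rw [← Finset.mul_sum, Finset.sum_add_distrib, Finset.sum_ite_eq, if_pos hP]
  have hvar : ∑ A ∈ monics F n, (w A - L) ^ 2 ≤ q ^ n * L := by
    have : ∑ A ∈ monics F n, (w A - L) ^ 2 =
        ∑ A ∈ monics F n, w A ^ 2 - 2 * L * ∑ A ∈ monics F n, w A + q ^ n * L ^ 2 := by
      rw [Finset.mul_sum, ← Finset.sum_sub_distrib]
      have hc : q ^ n * L ^ 2 = ∑ A ∈ monics F n, L ^ 2 := by
        rw [Finset.sum_const, card_monics, nsmul_eq_mul, Nat.cast_pow]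
      rw [hc, ← Finset.sum_add_distrib]
      exact Finset.sum_congr rfl fun A _ => by ring
    rw [this, hsum1]
    linarith
  have hsift : (sifted F a b n).card * L ^ 2 ≤ ∑ A ∈ monics F n, (w A - L) ^ 2 := by
    rw [← nsmul_eq_mul, ← Finset.sum_const]
    refine (Finset.sum_le_sum fun A hA => ?_).trans (Finset.sum_le_sum_of_subset_of_nonneg
      (Finset.filter_subset _ _) fun A _ _ => sq_nonneg _)
    obtain ⟨hA, hA'⟩ := Finset.mem_filter.1 hA
    have hA0 := (mem_monics.1 hA).1.ne_zero
    have : w A = 0 := Finset.sum_eq_zero fun P hP => if_neg fun hd => by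
      obtain ⟨hP, hab⟩ := (hmem P).1 hP
      exact hA' _ (Finset.mem_image_of_mem _ ((mem_primeDivisors hA0).2 ⟨hP, hd⟩))
        (Finset.mem_Ico.2 hab)
    rw [this, zero_sub, neg_sq]
  rcases hL0.eq_or_lt with h | h
  · rw [← h, mul_zero]
    positivity
  · refine le_of_mul_le_mul_right ?_ h
    calc (sifted F a b n).card * L * L = (sifted F a b n).card * L ^ 2 := by ring
      _ ≤ _ := hsift.trans hvar

/-- The monic polynomials of degree `n` whose prime divisors have at most one degree
above `m`. -/
noncomputable def atMostOneDegreeAbove (F : Type*) [Field F] [Finite F] (m n : ℕ) : Finset F[X] :=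
  {A ∈ monics F n | {j ∈ primeDegrees A | m < j}.card ≤ 1}

theorem tendsto_card_atMostOneDegreeAbove (m : ℕ) :
    Tendsto (fun n => (atMostOneDegreeAbove F m n).card / (Nat.card F : ℝ) ^ n) atTop (𝓝 0) := by
  rw [Metric.tendsto_atTop]
  intro ε hε
  -- Of two disjoint ranges of degrees above `m`, such a polynomial misses at least one.
  obtain ⟨b, hb⟩ := exists_le_sum_Ico_primeProportion (F := F) (m + 1) (4 / ε)
  obtain ⟨c, hc⟩ := exists_le_sum_Ico_primeProportion (F := F) (max b (m + 1)) (4 / ε)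
  refine ⟨2 * max b c, fun n hn => ?_⟩
  have hq : 0 < (Nat.card F : ℝ) ^ n := pow_pos (by exact_mod_cast Nat.card_pos) _
  have hsub : atMostOneDegreeAbove F m n ⊆
      sifted F (m + 1) b n ∪ sifted F (max b (m + 1)) c n := by
    intro A hA
    obtain ⟨hA, hcard⟩ := Finset.mem_filter.1 hA
    by_contra hnot
    simp only [sifted, Finset.mem_union, Finset.mem_filter, hA, true_and, not_or, not_forall,
      not_not, Finset.mem_Ico] at hnot
    obtain ⟨⟨i, hi, hi1, hi2⟩, ⟨j, hj, hj1, hj2⟩⟩ := hnot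
    have := Finset.card_le_one.1 hcard i (Finset.mem_filter.2 ⟨hi, by omega⟩) j
      (Finset.mem_filter.2 ⟨hj, by omega⟩)
    omega
  have hbound : ∀ a b', 4 / ε ≤ ∑ j ∈ Finset.Ico a b', primeProportion F j → 2 * b' ≤ n →
      ((sifted F a b' n).card : ℝ) ≤ ε / 4 * (Nat.card F : ℝ) ^ n := by
    intro a b' hs hb'
    have h := (mul_le_mul_of_nonneg_left hs (Nat.cast_nonneg (sifted F a b' n).card)).trans
      (card_sifted_mul_le hb')
    rw [mul_div_assoc', div_le_iff₀ hε] at h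
    linarith
  have h1 := hbound _ _ hb (by omega)
  have h2 := hbound _ _ hc (by omega)
  have h3 : ((atMostOneDegreeAbove F m n).card : ℝ) ≤
      (sifted F (m + 1) b n).card + (sifted F (max b (m + 1)) c n).card := by
    exact_mod_cast (Finset.card_le_card hsub).trans (Finset.card_union_le _ _)
  rw [Real.dist_eq, sub_zero, abs_of_nonneg (by positivity), div_lt_iff₀ hq]
  have : 0 < ε * (Nat.card F : ℝ) ^ n := by positivity
  linarith

/-! ### Mean values of the number of primes of a given rank -/

/-- The monic polynomials of degree `n` whose prime divisors have exactly `k` degrees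
above `m`. -/
noncomputable def exactDegreesAbove (F : Type*) [Field F] [Finite F] (k m n : ℕ) : Finset F[X] :=
  {A ∈ monics F n | {j ∈ primeDegrees A | m < j}.card = k}

/-- The proportion of `exactDegreesAbove` among the monic polynomials of degree `n`. -/
noncomputable def exactProportion (F : Type*) [Field F] [Finite F] (k m n : ℕ) : ℝ :=
  (exactDegreesAbove F k m n).card / (Nat.card F : ℝ) ^ n

theorem exactProportion_nonneg (k m n : ℕ) : 0 ≤ exactProportion F k m n := by
  unfold exactProportion; positivity

theorem exactProportion_le_one (k m n : ℕ) : exactProportion F k m n ≤ 1 := by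
  have hq : (0 : ℝ) < (Nat.card F : ℝ) ^ n := pow_pos (Nat.cast_pos.2 Nat.card_pos) _
  rw [exactProportion, div_le_one hq, ← Nat.cast_pow, ← card_monics (F := F) n]
  exact_mod_cast Finset.card_filter_le _ _

theorem tendsto_exactProportion {k : ℕ} (hk : k ≤ 1) (m : ℕ) :
    Tendsto (exactProportion F k m) atTop (𝓝 0) := by
  refine squeeze_zero (fun n => exactProportion_nonneg k m n) (fun n => ?_)
    (tendsto_card_atMostOneDegreeAbove (F := F) m)
  refine div_le_div_of_nonneg_right ?_ (by positivity)
  refine Nat.cast_le.2 (Finset.card_le_card fun A hA => ?_)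
  rw [exactDegreesAbove, Finset.mem_filter] at hA
  rw [atMostOneDegreeAbove, Finset.mem_filter]
  exact ⟨hA.1, hA.2.trans_le hk⟩

theorem card_filter_dvd_and_card_eq {D : F[X]} (hD : D.Monic) {k m n : ℕ}
    (hm : ∀ P ∈ primeDivisors D, P.natDegree ≤ m) :
    {A ∈ monics F n | D ∣ A ∧ {j ∈ primeDegrees A | m < j}.card = k}.card =
      if D.natDegree ≤ n then (exactDegreesAbove F k m (n - D.natDegree)).card else 0 := by
  rw [← Finset.filter_filter, Finset.card_filter]
  split_ifs with h
  · rw [sum_monics_filter_dvd hD h, exactDegreesAbove, Finset.card_filter]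
    refine Finset.sum_congr rfl fun B hB => ?_
    rw [primeDegrees_mul_filter_lt hD.ne_zero (mem_monics.1 hB).1.ne_zero hm]
  · rw [monics_filter_dvd_eq_empty (not_le.1 h), Finset.sum_empty]

theorem filter_natDegree_eq_filter_primesOfDegree {A : F[X]} (hA : A ≠ 0) (S : Set F[X]) (k m : ℕ) :
    {P ∈ {P ∈ primeDivisors A | P ∈ S ∧ {j ∈ primeDegrees A | P.natDegree < j}.card = k} |
      P.natDegree = m} =
    {P ∈ {P ∈ primesOfDegree F m | P ∈ S} |
      P ∣ A ∧ {j ∈ primeDegrees A | m < j}.card = k} := by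
  ext P
  simp only [Finset.mem_filter, mem_primeDivisors hA, mem_primesOfDegree]
  constructor
  · rintro ⟨⟨⟨hP, hd⟩, hS, hc⟩, rfl⟩
    exact ⟨⟨⟨hP, rfl⟩, hS⟩, hd, hc⟩
  · rintro ⟨⟨⟨hP, rfl⟩, hS⟩, hd, hc⟩
    exact ⟨⟨⟨hP, hd⟩, hS, hc⟩, rfl⟩

theorem sum_countKthLargest (S : Set F[X]) (k n : ℕ) :
    ∑ A ∈ monics F n, countKthLargest S (k + 1) A =
      ∑ m ∈ Finset.range (n + 1), primeCount S m * (exactDegreesAbove F k m (n - m)).card := by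
  have hpt : ∀ A ∈ monics F n, countKthLargest S (k + 1) A =
      ∑ m ∈ Finset.range (n + 1), ∑ P ∈ primesOfDegree F m with P ∈ S,
        if P ∣ A ∧ {j ∈ primeDegrees A | m < j}.card = k then 1 else 0 := by
    intro A hA
    rw [mem_monics] at hA
    rw [countKthLargest_eq hA.1.ne_zero,
      Finset.card_eq_sum_card_fiberwise (f := natDegree) (t := Finset.range (n + 1))]
    · refine Finset.sum_congr rfl fun m _ => ?_
      rw [filter_natDegree_eq_filter_primesOfDegree hA.1.ne_zero, Finset.card_filter]
    · intro P hP
      have hP := (mem_primeDivisors hA.1.ne_zero).1 (Finset.mem_filter.1 hP).1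
      have := natDegree_le_of_dvd hP.2 hA.1.ne_zero
      rw [Finset.mem_coe, Finset.mem_range]
      omega
  rw [Finset.sum_congr rfl hpt, Finset.sum_comm]
  refine Finset.sum_congr rfl fun m hm => ?_
  rw [Finset.sum_comm, primeCount_eq_card, ← smul_eq_mul, ← Finset.sum_const]
  refine Finset.sum_congr rfl fun P hP => ?_
  obtain ⟨hP', rfl⟩ := mem_primesOfDegree.1 (Finset.mem_filter.1 hP).1
  rw [← Finset.card_filter, card_filter_dvd_and_card_eq hP'.1, if_pos]
  · exact Nat.le_of_lt_succ (Finset.mem_range.1 hm)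
  · intro Q hQ
    rw [primeDivisors_of_isPrimePoly hP', Finset.mem_singleton] at hQ
    rw [hQ]

/-- The summand on the left is the number of ordered pairs of distinct primes in `S` that divide
`A` and have degree `Δ_{k+1}(A)`; the subtraction does not truncate. -/
theorem sum_countKthLargest_mul_sub_one_le (S : Set F[X]) (k n : ℕ) :
    ∑ A ∈ monics F n, (countKthLargest S (k + 1) A * countKthLargest S (k + 1) A -
        countKthLargest S (k + 1) A) ≤
      ∑ m ∈ Finset.range (n + 1), (primesOfDegree F m).card ^ 2 *
        if 2 * m ≤ n then (exactDegreesAbove F k m (n - 2 * m)).card else 0 := by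
  have hpt : ∀ A ∈ monics F n, countKthLargest S (k + 1) A * countKthLargest S (k + 1) A -
        countKthLargest S (k + 1) A ≤
      ∑ m ∈ Finset.range (n + 1), ∑ x ∈ (primesOfDegree F m).offDiag,
        if x.1 * x.2 ∣ A ∧ {j ∈ primeDegrees A | m < j}.card = k then 1 else 0 := by
    intro A hA
    rw [mem_monics] at hA
    have hA0 := hA.1.ne_zero
    rw [countKthLargest_eq hA0, ← Finset.offDiag_card,
      Finset.card_eq_sum_card_fiberwise (f := fun x => x.1.natDegree) (t := Finset.range (n + 1))]
    · refine Finset.sum_le_sum fun m _ => ?_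
      rw [← Finset.card_filter]
      refine Finset.card_le_card ?_
      rintro ⟨P, Q⟩ h
      simp only [Finset.mem_filter, Finset.mem_offDiag] at h ⊢
      obtain ⟨⟨⟨hP, -, hPk⟩, ⟨hQ, -, hQk⟩, hne⟩, rfl⟩ := h
      have hdeg : Q.natDegree = P.natDegree :=
        ((natDegree_eq_kthLargest_iff hA0 hQ k).2 hQk).trans
          ((natDegree_eq_kthLargest_iff hA0 hP k).2 hPk).symm
      rw [mem_primeDivisors hA0] at hP hQ
      exact ⟨⟨mem_primesOfDegree.2 ⟨hP.1, rfl⟩, mem_primesOfDegree.2 ⟨hQ.1, hdeg⟩, hne⟩,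
        (hP.1.isCoprime hQ.1 hne).mul_dvd hP.2 hQ.2, hPk⟩
    · rintro ⟨P, Q⟩ h
      have hP := (mem_primeDivisors hA0).1 (Finset.mem_filter.1 (Finset.mem_offDiag.1 h).1).1
      have : P.natDegree ≤ n := hA.2 ▸ natDegree_le_of_dvd hP.2 hA0
      exact Finset.mem_coe.2 (Finset.mem_range.2 (Nat.lt_succ_of_le this))
  refine (Finset.sum_le_sum hpt).trans ?_
  rw [Finset.sum_comm]
  refine Finset.sum_le_sum fun m hm => ?_
  rw [Finset.sum_comm]
  have hterm : ∀ x ∈ (primesOfDegree F m).offDiag,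
      (∑ A ∈ monics F n, if x.1 * x.2 ∣ A ∧ {j ∈ primeDegrees A | m < j}.card = k then 1 else 0) =
        if 2 * m ≤ n then (exactDegreesAbove F k m (n - 2 * m)).card else 0 := by
    rintro ⟨P, Q⟩ h
    obtain ⟨hP, hQ, -⟩ := Finset.mem_offDiag.1 h
    obtain ⟨hP, hPm⟩ := mem_primesOfDegree.1 hP
    obtain ⟨hQ, hQm⟩ := mem_primesOfDegree.1 hQ
    have hd : (P * Q).natDegree = 2 * m := by
      rw [hP.1.natDegree_mul hQ.1, hPm, hQm, two_mul]
    rw [← Finset.card_filter, card_filter_dvd_and_card_eq (hP.1.mul hQ.1), hd]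
    intro R hR
    rw [primeDivisors_mul hP.2.ne_zero hQ.2.ne_zero, primeDivisors_of_isPrimePoly hP,
      primeDivisors_of_isPrimePoly hQ, Finset.mem_union, Finset.mem_singleton,
      Finset.mem_singleton] at hR
    rcases hR with rfl | rfl
    exacts [hPm.le, hQm.le]
  rw [Finset.sum_congr rfl hterm, Finset.sum_const, smul_eq_mul, Finset.offDiag_card, sq]
  exact Nat.mul_le_mul_right _ (Nat.sub_le _ _)

/-- The contribution of the primes of degree `m` to the mean over the monic `A` of degree `n` of
the number of primes dividing `A` of degree `Δ_{k+1}(A)`. -/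
noncomputable def degreeWeight (F : Type*) [Field F] [Finite F] (k n m : ℕ) : ℝ :=
  if m ≤ n then primeProportion F m * exactProportion F k m (n - m) else 0

theorem degreeWeight_nonneg (k n m : ℕ) : 0 ≤ degreeWeight F k n m := by
  unfold degreeWeight
  split_ifs
  · exact mul_nonneg (primeProportion_nonneg _) (exactProportion_nonneg _ _ _)
  · exact le_rfl

theorem tendsto_degreeWeight {k : ℕ} (hk : k ≤ 1) (m : ℕ) :
    Tendsto (fun n => degreeWeight F k n m) atTop (𝓝 0) := by
  have h := ((tendsto_exactProportion (F := F) hk m).comp (tendsto_sub_atTop_nat m)).const_mul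
    (primeProportion F m)
  rw [mul_zero] at h
  refine h.congr' ?_
  filter_upwards [eventually_ge_atTop m] with n hn
  rw [degreeWeight, if_pos hn, Function.comp_apply]

theorem sum_countKthLargest_div (S : Set F[X]) (k n : ℕ) :
    (∑ A ∈ monics F n, (countKthLargest S (k + 1) A : ℝ)) / (Nat.card F : ℝ) ^ n =
      ∑ m ∈ Finset.range (n + 1), degreeWeight F k n m *
        ((primeCount S m : ℝ) / (primeCount {P : F[X] | IsPrimePoly P} m : ℝ)) := by
  have hq : (Nat.card F : ℝ) ≠ 0 := (Nat.cast_pos.2 Nat.card_pos).ne'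
  rw [← Nat.cast_sum, sum_countKthLargest, Nat.cast_sum, Finset.sum_div]
  refine Finset.sum_congr rfl fun m hm => ?_
  have hmn : m ≤ n := Nat.le_of_lt_succ (Finset.mem_range.1 hm)
  rw [degreeWeight, if_pos hmn, primeCount_setOf_isPrimePoly, primeProportion, exactProportion,
    Nat.cast_mul]
  have hpow : (Nat.card F : ℝ) ^ n = (Nat.card F : ℝ) ^ m * (Nat.card F : ℝ) ^ (n - m) := by
    rw [← pow_add, Nat.add_sub_cancel' hmn]
  -- If there is no prime of degree `m`, both sides vanish.
  rcases Nat.eq_zero_or_pos (primesOfDegree F m).card with h | h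
  · have h' : primeCount S m = 0 := Nat.le_zero.1 (h ▸ primeCount_le_card S m)
    simp [h']
  · have hc : ((primesOfDegree F m).card : ℝ) ≠ 0 := by exact_mod_cast h.ne'
    rw [hpow]
    field_simp

/-- Two distinct primes of the same rank `k + 1` occur with density zero, even when counted with
multiplicity: this rests on the convergence of `∑ 1 / m ^ 2`. -/
theorem tendsto_sum_countKthLargest_mul_sub_one (S : Set F[X]) {k : ℕ} (hk : k ≤ 1) :
    Tendsto (fun n => ((∑ A ∈ monics F n, (countKthLargest S (k + 1) A *
        countKthLargest S (k + 1) A - countKthLargest S (k + 1) A) : ℕ) : ℝ) /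
          (Nat.card F : ℝ) ^ n) atTop (𝓝 0) := by
  have hq : (Nat.card F : ℝ) ≠ 0 := (Nat.cast_pos.2 Nat.card_pos).ne'
  set g : ℕ → ℕ → ℝ := fun n m =>
    if 2 * m ≤ n then primeProportion F m ^ 2 * exactProportion F k m (n - 2 * m) else 0 with hg
  have hg0 : ∀ n m, 0 ≤ g n m := by
    intro n m
    simp only [hg]
    split_ifs
    · exact mul_nonneg (sq_nonneg _) (exactProportion_nonneg _ _ _)
    · exact le_rfl
  have hgle : ∀ n m, g n m ≤ 1 / (m : ℝ) ^ 2 := by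
    intro n m
    simp only [hg]
    split_ifs
    · calc primeProportion F m ^ 2 * exactProportion F k m (n - 2 * m)
          ≤ (1 / m : ℝ) ^ 2 * 1 :=
            mul_le_mul (pow_le_pow_left₀ (primeProportion_nonneg m) (primeProportion_le m) 2)
              (exactProportion_le_one _ _ _) (exactProportion_nonneg _ _ _) (by positivity)
        _ = 1 / (m : ℝ) ^ 2 := by rw [mul_one, one_div_pow]
    · positivity
  have hlim : ∀ m, Tendsto (fun n => g n m) atTop (𝓝 0) := by
    intro m
    have h := ((tendsto_exactProportion (F := F) hk m).comp
      (tendsto_sub_atTop_nat (2 * m))).const_mul (primeProportion F m ^ 2)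
    rw [mul_zero] at h
    refine h.congr' ?_
    filter_upwards [eventually_ge_atTop (2 * m)] with n hn
    simp only [hg]
    rw [if_pos hn, Function.comp_apply]
  have hdom := tendsto_tsum_of_dominated_convergence (f := g) (g := fun _ => (0 : ℝ)) (𝓕 := atTop)
    (Real.summable_one_div_nat_pow.2 one_lt_two) hlim
    (Eventually.of_forall fun n m => by rw [Real.norm_of_nonneg (hg0 n m)]; exact hgle n m)
  rw [tsum_zero] at hdom
  refine squeeze_zero (fun n => by positivity) (fun n => ?_) hdom
  rw [tsum_eq_sum (s := Finset.range (n + 1)) fun m hm => ?_]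
  · refine (div_le_div_of_nonneg_right (Nat.cast_le.2
      (sum_countKthLargest_mul_sub_one_le S k n)) (by positivity)).trans_eq ?_
    rw [Nat.cast_sum, Finset.sum_div]
    refine Finset.sum_congr rfl fun m _ => ?_
    simp only [hg]
    split_ifs with h
    · have hpow : (Nat.card F : ℝ) ^ n =
          (Nat.card F : ℝ) ^ m * (Nat.card F : ℝ) ^ m * (Nat.card F : ℝ) ^ (n - 2 * m) := by
        rw [← pow_add, ← pow_add]
        congr 1
        omega
      rw [primeProportion, exactProportion, hpow, Nat.cast_mul, Nat.cast_pow]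
      field_simp
    · simp
  · rw [Finset.mem_range] at hm
    simp only [hg]
    rw [if_neg (by omega)]

/-- On average there is exactly one prime of the largest, and one of the second largest, degree. -/
theorem tendsto_mean_countKthLargest {k : ℕ} (hk : k ≤ 1) :
    Tendsto (fun n => (∑ A ∈ monics F n,
      (countKthLargest {P : F[X] | IsPrimePoly P} (k + 1) A : ℝ)) / (Nat.card F : ℝ) ^ n)
      atTop (𝓝 1) := by
  set Q : F[X] → ℕ := countKthLargest {P : F[X] | IsPrimePoly P} (k + 1) with hQ
  have hlow := (tendsto_const_nhds (x := (1 : ℝ))).sub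
    (tendsto_card_atMostOneDegreeAbove (F := F) 0)
  have hup := (tendsto_const_nhds (x := (1 : ℝ))).add
    (tendsto_sum_countKthLargest_mul_sub_one {P : F[X] | IsPrimePoly P} hk)
  rw [sub_zero] at hlow
  rw [add_zero] at hup
  have hone : ∀ n, (1 : ℝ) = (∑ A ∈ monics F n, (1 : ℝ)) / (Nat.card F : ℝ) ^ n := by
    intro n
    have hq : (Nat.card F : ℝ) ^ n ≠ 0 := pow_ne_zero _ (Nat.cast_pos.2 Nat.card_pos).ne'
    rw [Finset.sum_const, card_monics, nsmul_one, Nat.cast_pow, div_self hq]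
  refine tendsto_of_tendsto_of_tendsto_of_le_of_le hlow hup (fun n => ?_) (fun n => ?_)
  · simp only
    nth_rewrite 1 [hone n]
    rw [← sub_div, atMostOneDegreeAbove, Finset.card_filter, Nat.cast_sum,
      ← Finset.sum_sub_distrib]
    refine div_le_div_of_nonneg_right (Finset.sum_le_sum fun A hA => ?_) (by positivity)
    have hA0 := (mem_monics.1 hA).1.ne_zero
    split_ifs with h
    · simp
    · rw [Nat.cast_zero, sub_zero, Nat.one_le_cast, hQ, countKthLargest, Nat.one_le_iff_ne_zero,
        Finset.card_ne_zero]
      have hlt : k < numDegrees A :=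
        (hk.trans_lt (not_le.1 h)).trans_le (Finset.card_filter_le _ _)
      obtain ⟨P, hP, hd⟩ := exists_natDegree_eq_kthLargest hlt
      exact ⟨P, Finset.mem_filter.2 ⟨hP, ((mem_primeDivisors hA0).1 hP).1, hd⟩⟩
  · simp only
    nth_rewrite 1 [hone n]
    rw [← add_div, Nat.cast_sum, ← Finset.sum_add_distrib]
    refine div_le_div_of_nonneg_right (Finset.sum_le_sum fun A _ => ?_) (by positivity)
    -- `Q ≤ 1 + Q (Q - 1)` for every natural number `Q`.
    have : Q A ≤ 1 + (Q A * Q A - Q A) := by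
      rcases Nat.lt_or_ge (Q A) 2 with h | h
      · omega
      · have := Nat.mul_le_mul_right (Q A) h
        omega
    exact_mod_cast this

/-- Toeplitz's summation lemma. -/
theorem tendsto_sum_mul_of_tendsto {w : ℕ → ℕ → ℝ} {r : ℕ → ℝ} {δ : ℝ}
    (hw0 : ∀ n m, 0 ≤ w n m) (hw : ∀ m, Tendsto (fun n => w n m) atTop (𝓝 0))
    (hsum : Tendsto (fun n => ∑ m ∈ Finset.range (n + 1), w n m) atTop (𝓝 1))
    (hr : Tendsto r atTop (𝓝 δ)) :
    Tendsto (fun n => ∑ m ∈ Finset.range (n + 1), w n m * r m) atTop (𝓝 δ) := by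
  suffices h : Tendsto (fun n => ∑ m ∈ Finset.range (n + 1), w n m * (r m - δ)) atTop (𝓝 0) by
    have h' := h.add (hsum.mul_const δ)
    rw [zero_add, one_mul] at h'
    refine h'.congr fun n => ?_
    rw [Finset.sum_mul, ← Finset.sum_add_distrib]
    exact Finset.sum_congr rfl fun m _ => by ring
  rw [Metric.tendsto_atTop]
  intro ε hε
  obtain ⟨M, hM⟩ := (Metric.tendsto_atTop.1 hr) (ε / 4) (by positivity)
  have hhead : Tendsto (fun n => ∑ m ∈ Finset.range M, w n m * |r m - δ|) atTop (𝓝 0) := by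
    have := tendsto_finsetSum (Finset.range M) fun m _ => (hw m).mul_const |r m - δ|
    simpa using this
  have h1 := hhead.eventually_lt_const (half_pos hε)
  have h2 := hsum.eventually_lt_const one_lt_two
  obtain ⟨N, hN⟩ := eventually_atTop.1 (h1.and (h2.and (eventually_ge_atTop M)))
  refine ⟨N, fun n hn => ?_⟩
  obtain ⟨h1, h2, h3⟩ := hN n hn
  rw [Real.dist_eq, sub_zero]
  have hle : ∀ m, |w n m * (r m - δ)| = w n m * |r m - δ| := fun m => by
    rw [abs_mul, abs_of_nonneg (hw0 n m)]
  calc |∑ m ∈ Finset.range (n + 1), w n m * (r m - δ)|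
      ≤ ∑ m ∈ Finset.range (n + 1), w n m * |r m - δ| :=
        (Finset.abs_sum_le_sum_abs _ _).trans_eq (Finset.sum_congr rfl fun m _ => hle m)
    _ = ∑ m ∈ Finset.range M, w n m * |r m - δ| +
          ∑ m ∈ Finset.Ico M (n + 1), w n m * |r m - δ| :=
        (Finset.sum_range_add_sum_Ico _ (by omega)).symm
    _ ≤ ∑ m ∈ Finset.range M, w n m * |r m - δ| +
          ∑ m ∈ Finset.range (n + 1), w n m * (ε / 4) := by
        gcongr
        refine (Finset.sum_le_sum fun m hm => ?_).trans (Finset.sum_le_sum_of_subset_of_nonneg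
          (f := fun m => w n m * (ε / 4)) ?_ ?_)
        · exact mul_le_mul_of_nonneg_left (hM m (Finset.mem_Ico.1 hm).1).le (hw0 n m)
        · intro m hm
          exact Finset.mem_range.2 (Finset.mem_Ico.1 hm).2
        · intro m _ _
          have := hw0 n m
          positivity
    _ < ε := by
        rw [← Finset.sum_mul]
        have := mul_lt_mul_of_pos_right h2 (by positivity : 0 < ε / 4)
        linarith

/-- The mean value of `Q_S^{(k)}` is the density of `S`, for `k = 1` and `k = 2`. -/
theorem HasNaturalDensity.tendsto_mean_countKthLargest {S : Set F[X]} {δ : ℝ}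
    (hδ : HasNaturalDensity S δ) {k : ℕ} (hk : k ≤ 1) :
    Tendsto (fun n => (∑ A ∈ monics F n, (countKthLargest S (k + 1) A : ℝ)) /
      (Nat.card F : ℝ) ^ n) atTop (𝓝 δ) := by
  refine (tendsto_sum_mul_of_tendsto (degreeWeight_nonneg k) (tendsto_degreeWeight (F := F) hk)
    ?_ hδ).congr fun n => (sum_countKthLargest_div S k n).symm
  refine (FqT.tendsto_mean_countKthLargest (F := F) hk).congr fun n => ?_
  rw [sum_countKthLargest_div]
  refine Finset.sum_congr rfl fun m _ => ?_
  rcases Nat.eq_zero_or_pos (primesOfDegree F m).card with h | h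
  · simp [degreeWeight, primeProportion, h]
  · rw [primeCount_setOf_isPrimePoly, div_self (by exact_mod_cast h.ne'), mul_one]

end FqT

open scoped Classical in
theorem mainTheorem4 {F : Type*} [Field F] [Finite F] (S : Set F[X])
    (hS : ∀ P ∈ S, FqT.IsPrimePoly P) (δ : ℝ) (hδ : FqT.HasNaturalDensity S δ) :
    Tendsto
      (fun x : ℕ =>
        ∑ A ∈ FqT.monicsUpTo F x with 1 ≤ A.natDegree ∧ A ∈ FqT.uniqueMinIn S,
          ((UniqueFactorizationMonoid.moebius A : ℤ) : ℝ) * (FqT.numDegrees A : ℝ)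
            / (Nat.card F : ℝ) ^ A.natDegree)
      atTop (𝓝 0) ∧
    Tendsto
      (fun n : ℕ =>
        (∑ A ∈ FqT.monicsUpTo F n with A.natDegree = n, (FqT.countKthLargest S 2 A : ℝ))
          / (Nat.card F : ℝ) ^ n)
      atTop (𝓝 δ) := by
  have h1 := hδ.tendsto_mean_countKthLargest zero_le_one
  have h2 := hδ.tendsto_mean_countKthLargest le_rfl
  have hdiff := h2.sub h1
  rw [sub_self] at hdiff
  refine ⟨hdiff.congr fun n => (FqT.sum_moebius_mul_numDegrees_div S n).symm, ?_⟩
  convert h2 using 4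
  rw [FqT.monics]
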